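/- Let $R:\mathbb{R}^n\to\mathbb{Z}^n$ be a quantizer, that is, $R(u+z)=R(u)+z$ for all $u\in\mathbb{R}^n$, $z\in\mathbb{Z}^n$, and the set $R^{-1}(0)$ is Jordan measurable (bounded, with boundary of Lebesgue measure zero). Let $L\in\mathbb{R}^{n\times n}$ be nonsingular and iteratively nonresonant: for any finite submatrix $\Lambda$ formed by distinct rows of the infinite matrix obtained by stacking all the nonzero integer powers $\ldots,L^{-2},L^{-1},L,L^2,\ldots$, the rows of $\begin{bmatrix} I_n\\ \Lambda\end{bmatrix}$ are linearly independent over $\mathbb{Q}$. Let $T:=R\circ L:\mathbb{Z}^n\to\mathbb{Z}^n$. For $N\geq 1$, let $\mathcal{P}_N$ be the class of the discrete parallelepipeds $\{x\in\mathbb{Z}^n: a_k\leq x_k<a_k+\ell_k \text{ for all } k\}$ with $a,\ell\in\mathbb{Z}^n$ and $\min_k\ell_k\geq N$. A set $A\subset\mathbb{Z}^n$ is frequency measurable, with frequency $\mathbf{F}(A)$, if $$\sup_{N\geq 1}\ \inf_{P\in\mathcal{P}_N}\frac{\#(A\cap P)}{\#P}=\inf_{N\geq 1}\ \sup_{P\in\mathcal{P}_N}\frac{\#(A\cap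 P)}{\#P}=\mathbf{F}(A).$$ Let $\mu:=\int_{R^{-1}(0)}u\,\mathrm{d}u$ and $\widetilde R(u):=R(u+(I_n+L^{-1})\mu)$, and for finite sets $A,B\subset\mathbb{Z}^n$ let $$\Delta(B\mid A):=\mathrm{mes}_n\big\{u\in\widetilde R^{-1}(0):\ \mathbb{Z}^n\cap\big(u+L^{-1}(A+R^{-1}(0))\big)=B\big\},$$ where $\mathrm{mes}_n$ is the $n$-dimensional Lebesgue measure. Let $\Pi$ be the class of nonempty finite subsets of $\mathbb{Z}^n$. Then the recurrence $$H_0=1,\qquad H_N(A)=\sum_{B\in\Pi}\Delta(B\mid A)\,H_{N-1}(B)\qquad (A\in\Pi,\ N\geq 1)$$ defines (by convergent series) functions $H_N:\Pi\to[0,1]$, and for every $N\geq 1$ the set $T^N(\mathbb{Z}^n)$ of points reachable in $N$ iterates of $T$ is frequency measurable, with $$\mathbf{F}\big(T^N(\mathbb{Z}^n)\big)=H_N(\{0\}).$$ -/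

import Mathlib

open MeasureTheory

noncomputable section

namespace QuantizedLinear

variable {n : ℕ}

/-- The inclusion of the integer lattice `ℤⁿ` into `ℝⁿ`. -/
def latticeCoe (z : Fin n → ℤ) : Fin n → ℝ := fun i => (z i : ℝ)

/-! ### Averages and frequencies on the integer lattice -/

/-- The average value of `f` over a finite set `P` of lattice points. -/
def windowAverage (f : (Fin n → ℤ) → ℝ) (P : Finset (Fin n → ℤ)) : ℝ :=
  (∑ x ∈ P, f x) / (P.card : ℝ)

/-- The discrete parallelepiped of all `x ∈ ℤⁿ` with `a k ≤ x k < a k + ℓ k` for every `k`. -/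
def box (a ℓ : Fin n → ℤ) : Finset (Fin n → ℤ) :=
  Fintype.piFinset fun k => Finset.Ico (a k) (a k + ℓ k)

/-- The discrete parallelepipeds all of whose edge lengths are at least `N`. -/
def largeBoxes (n N : ℕ) : Set (Finset (Fin n → ℤ)) :=
  {P | ∃ a ℓ : Fin n → ℤ, (∀ k, (N : ℤ) ≤ ℓ k) ∧ P = box a ℓ}

/-- The lower average value `sup_{N ≥ 1} inf_{P ∈ 𝒫_N} W(f, P)` of a bounded function. -/
def lowerAverage (f : (Fin n → ℤ) → ℝ) : ℝ :=
  ⨆ N : ℕ+, ⨅ P : largeBoxes n N, windowAverage f P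

/-- The upper average value `inf_{N ≥ 1} sup_{P ∈ 𝒫_N} W(f, P)` of a bounded function. -/
def upperAverage (f : (Fin n → ℤ) → ℝ) : ℝ :=
  ⨅ N : ℕ+, ⨆ P : largeBoxes n N, windowAverage f P

/-- The lower frequency of a set of lattice points. -/
def lowerFrequency (A : Set (Fin n → ℤ)) : ℝ := lowerAverage (A.indicator fun _ => 1)

/-- The upper frequency of a set of lattice points. -/
def upperFrequency (A : Set (Fin n → ℤ)) : ℝ := upperAverage (A.indicator fun _ => 1)

/-- `A` is frequency measurable and its frequency is `c`. -/
def HasFrequency (A : Set (Fin n → ℤ)) (c : ℝ) : Prop :=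
  lowerFrequency A = c ∧ upperFrequency A = c

/-! ### Nonresonance -/

/-- The rows of the identity matrix stacked upon `Λ` are linearly independent over `ℚ`. -/
def Nonresonant {ι : Type*} (Λ : Matrix ι (Fin n) ℝ) : Prop :=
  LinearIndependent ℚ (Matrix.fromRows (1 : Matrix (Fin n) (Fin n) ℝ) Λ).row

/-- The infinite matrix obtained by stacking all the nonzero integer powers of `L`. -/
def stackedPowers (L : Matrix (Fin n) (Fin n) ℝ) :
    Matrix ({k : ℤ // k ≠ 0} × Fin n) (Fin n) ℝ :=
  Matrix.of fun p j => (L ^ (p.1 : ℤ)) p.2 j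

/-- A nonsingular matrix is iteratively nonresonant if every submatrix formed by finitely many
(distinct) rows of the stack of its nonzero integer powers is nonresonant. -/
def IterativelyNonresonant (L : Matrix (Fin n) (Fin n) ℝ) : Prop :=
  IsUnit L.det ∧
    ∀ (m : ℕ) (f : Fin m ↪ {k : ℤ // k ≠ 0} × Fin n),
      Nonresonant ((stackedPowers L).submatrix f id)

/-! ### Quantized linear systems -/

/-- Jordan measurability: bounded, with a boundary of Lebesgue measure zero. -/
def JordanMeasurable (G : Set (Fin n → ℝ)) : Prop :=
  Bornology.IsBounded G ∧ volume (frontier G) = 0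

/-- A quantizer commutes with the translations of the lattice, and the cell of points that are
quantized to `0` is Jordan measurable. -/
structure IsQuantizer (R : (Fin n → ℝ) → (Fin n → ℤ)) : Prop where
  map_add_lattice : ∀ (u : Fin n → ℝ) (z : Fin n → ℤ), R (u + latticeCoe z) = R u + z
  jordanMeasurable_cell : JordanMeasurable (R ⁻¹' {0})

/-- The transition operator `T = R ∘ L` of the quantized linear `(R, L)`-system. -/
def transition (R : (Fin n → ℝ) → (Fin n → ℤ)) (L : Matrix (Fin n) (Fin n) ℝ)
    (x : Fin n → ℤ) : Fin n → ℤ :=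
  R (L.mulVec (latticeCoe x))

/-- The set `T^N(ℤⁿ)` of points which are reachable in `N` iterates of `T`. -/
def reachable (R : (Fin n → ℝ) → (Fin n → ℤ)) (L : Matrix (Fin n) (Fin n) ℝ) (N : ℕ) :
    Set (Fin n → ℤ) :=
  (transition R L)^[N] '' Set.univ

/-- The mean vector `μ` of the uniform distribution over the cell of the quantizer. -/
def cellMean (R : (Fin n → ℝ) → (Fin n → ℤ)) : Fin n → ℝ :=
  ∫ u in R ⁻¹' {0}, u

/-- The quantizer of the compensating system, `u ↦ R (u + (I + L⁻¹) μ)`. -/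
def compensatingQuantizer (R : (Fin n → ℝ) → (Fin n → ℤ)) (L : Matrix (Fin n) (Fin n) ℝ)
    (u : Fin n → ℝ) : Fin n → ℤ :=
  R (u + (1 + L⁻¹).mulVec (cellMean R))

/-- The set `ℤⁿ ∩ (u + L⁻¹ (A + R⁻¹(0)))`. -/
def chainStep (R : (Fin n → ℝ) → (Fin n → ℤ)) (L : Matrix (Fin n) (Fin n) ℝ)
    (A : Finset (Fin n → ℤ)) (u : Fin n → ℝ) : Set (Fin n → ℤ) :=
  {z | ∃ a ∈ A, ∃ v ∈ R ⁻¹' {0}, latticeCoe z = u + L⁻¹.mulVec (latticeCoe a + v)}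

/-- The transition kernel: `kernel R L B A` is `Δ(B ∣ A)`, the Lebesgue measure of the set of those
`u` in the cell of the compensating quantizer for which `ℤⁿ ∩ (u + L⁻¹ (A + R⁻¹(0))) = B`. -/
def kernel (R : (Fin n → ℝ) → (Fin n → ℤ)) (L : Matrix (Fin n) (Fin n) ℝ)
    (B A : Finset (Fin n → ℤ)) : ℝ :=
  (volume {u : Fin n → ℝ | u ∈ compensatingQuantizer R L ⁻¹' {0} ∧
    chainStep R L A u = (B : Set (Fin n → ℤ))}).toReal

/-- The class of nonempty finite subsets of the lattice. -/
abbrev NonemptyFinset (n : ℕ) : Type := {A : Finset (Fin n → ℤ) // A.Nonempty}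

/-- The set `{0}`. -/
def originSet (n : ℕ) : NonemptyFinset n := ⟨{0}, Finset.singleton_nonempty 0⟩

/-- The functions `H_N`: `H_0 = 1` and `H_{N+1}(A) = ∑_B Δ(B ∣ A) H_N(B)`, where `B` runs over
the nonempty finite subsets of the lattice. -/
def survival (R : (Fin n → ℝ) → (Fin n → ℤ)) (L : Matrix (Fin n) (Fin n) ℝ) :
    ℕ → NonemptyFinset n → ℝ
  | 0, _ => 1
  | N + 1, A => ∑' B : NonemptyFinset n, kernel R L B.1 A.1 * survival R L N B

end QuantizedLinear

end

open MeasureTheory Filter Topology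

noncomputable section

namespace QuantizedLinear

variable {n : ℕ}

/-! ### Frequencies as limits along large boxes -/

/-- The filter of nonempty finite sets generated by the large boxes. -/
def boxFilter (n : ℕ) : Filter (NonemptyFinset n) :=
  ⨅ N : ℕ+, 𝓟 {P | P.1 ∈ largeBoxes n N}

theorem largeBoxes_anti {M N : ℕ} (h : M ≤ N) : largeBoxes n N ⊆ largeBoxes n M := by
  rintro P ⟨a, ℓ, hl, rfl⟩
  exact ⟨a, ℓ, fun k => le_trans (by exact_mod_cast h) (hl k), rfl⟩

theorem nonempty_of_mem_largeBoxes {N : ℕ+} {P : Finset (Fin n → ℤ)}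
    (h : P ∈ largeBoxes n N) : P.Nonempty := by
  obtain ⟨a, ℓ, hl, rfl⟩ := h
  refine Fintype.piFinset_nonempty.2 fun k => Finset.nonempty_Ico.2 ?_
  have := hl k
  have := N.pos
  lia

theorem hasBasis_boxFilter (n : ℕ) :
    (boxFilter n).HasBasis (fun _ : ℕ+ => True) fun N => {P | P.1 ∈ largeBoxes n N} := by
  refine hasBasis_iInf_principal fun M N => ⟨max M N, ?_, ?_⟩
  · exact fun P hP => largeBoxes_anti (by simp) hP
  · exact fun P hP => largeBoxes_anti (by simp) hP

theorem box_mem_largeBoxes (n N : ℕ) : box (0 : Fin n → ℤ) (fun _ => N) ∈ largeBoxes n N :=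
  ⟨0, fun _ => N, fun _ => le_rfl, rfl⟩

theorem windowAverage_indicator_mem_Icc (A : Set (Fin n → ℤ)) (P : Finset (Fin n → ℤ)) :
    windowAverage (A.indicator fun _ => 1) P ∈ Set.Icc (0 : ℝ) 1 := by
  refine ⟨div_nonneg (Finset.sum_nonneg fun x _ => Set.indicator_nonneg (by simp) x)
    (Nat.cast_nonneg _), div_le_one_of_le₀ ?_ (Nat.cast_nonneg _)⟩
  refine (Finset.sum_le_card_nsmul P _ 1 fun x _ => ?_).trans (by simp)
  exact Set.indicator_le_self' (by simp) x

/-- If the averages over the boxes converge as the boxes grow, the frequency is the limit. -/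
theorem hasFrequency_of_tendsto {A : Set (Fin n → ℤ)} {c : ℝ}
    (h : Tendsto (fun P : NonemptyFinset n => windowAverage (A.indicator fun _ => 1) P.1)
      (boxFilter n) (𝓝 c)) : HasFrequency A c := by
  set W := windowAverage (A.indicator fun _ => (1 : ℝ)) with hW
  have h0 : ∀ P, 0 ≤ W P := fun P => (windowAverage_indicator_mem_Icc A P).1
  have h1 : ∀ P, W P ≤ 1 := fun P => (windowAverage_indicator_mem_Icc A P).2
  have hne : ∀ N : ℕ+, Nonempty (largeBoxes n N) := fun N => ⟨⟨_, box_mem_largeBoxes n N⟩⟩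
  have hbb : ∀ N : ℕ+, BddBelow (Set.range fun P : largeBoxes n N => W P) :=
    fun N => ⟨0, by rintro _ ⟨P, rfl⟩; exact h0 P⟩
  have hba : ∀ N : ℕ+, BddAbove (Set.range fun P : largeBoxes n N => W P) :=
    fun N => ⟨1, by rintro _ ⟨P, rfl⟩; exact h1 P⟩
  have hε : ∀ ε > 0, ∃ N : ℕ+, ∀ P ∈ largeBoxes n N, |W P - c| < ε := by
    intro ε hε
    obtain ⟨N, -, hN⟩ := ((hasBasis_boxFilter n).tendsto_iff Metric.nhds_basis_ball).1 h ε hε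
    exact ⟨N, fun P hP => hN ⟨P, nonempty_of_mem_largeBoxes hP⟩ hP⟩
  have hcommon : ∀ M N : ℕ+, ∃ P, P ∈ largeBoxes n M ∧ P ∈ largeBoxes n N := fun M N =>
    ⟨_, largeBoxes_anti (le_max_left (M : ℕ) N) (box_mem_largeBoxes n _),
      largeBoxes_anti (le_max_right (M : ℕ) N) (box_mem_largeBoxes n _)⟩
  constructor
  · apply le_antisymm
    · refine ciSup_le fun M => le_of_forall_pos_le_add fun ε hpos => ?_
      obtain ⟨N, hN⟩ := hε ε hpos
      obtain ⟨P, hM, hP⟩ := hcommon M N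
      refine ciInf_le_of_le (hbb M) ⟨P, hM⟩ ?_
      have := (abs_lt.1 (hN P hP)).2
      change W P ≤ _
      linarith
    · refine le_of_forall_pos_le_add fun ε hpos => ?_
      obtain ⟨N, hN⟩ := hε ε hpos
      rw [← sub_le_iff_le_add]
      refine le_ciSup_of_le ⟨1, ?_⟩ N (le_ciInf fun P => ?_)
      · rintro _ ⟨M, rfl⟩
        exact ciInf_le_of_le (hbb M) (hne M).some (h1 _)
      · have := (abs_lt.1 (hN P P.2)).1
        change _ ≤ W P
        linarith
  · apply le_antisymm
    · refine le_of_forall_pos_le_add fun ε hpos => ?_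
      obtain ⟨N, hN⟩ := hε ε hpos
      refine ciInf_le_of_le ⟨0, ?_⟩ N (ciSup_le fun P => ?_)
      · rintro _ ⟨M, rfl⟩
        exact le_ciSup_of_le (hba M) (hne M).some (h0 _)
      · have := (abs_lt.1 (hN P P.2)).2
        change W P ≤ _
        linarith
    · refine le_ciInf fun M => le_of_forall_pos_le_add fun ε hpos => ?_
      obtain ⟨N, hN⟩ := hε ε hpos
      obtain ⟨P, hM, hP⟩ := hcommon M N
      rw [← sub_le_iff_le_add]
      refine le_ciSup_of_le (hba M) ⟨P, hM⟩ ?_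
      have := (abs_lt.1 (hN P hP)).1
      change _ ≤ W P
      linarith

/-! ### Weyl's equidistribution theorem over boxes -/

theorem norm_sum_Ico_zpow_mul_le {e : ℂ} (he : ‖e‖ = 1) (a ℓ : ℤ) :
    ‖∑ k ∈ Finset.Ico a (a + ℓ), e ^ k‖ * ‖e - 1‖ ≤ 2 := by
  have he0 : e ≠ 0 := by
    rintro rfl
    simp at he
  rw [← norm_mul, Int.Ico_eq_finset_map, Finset.sum_map]
  have : ∀ i : ℕ, e ^ (Nat.castEmbedding.trans (addLeftEmbedding a) i : ℤ) = e ^ a * e ^ i := by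
    intro i
    simp [zpow_add₀ he0]
  simp only [this]
  rw [← Finset.mul_sum, mul_assoc, geom_sum_mul, norm_mul, norm_zpow, he, one_zpow, one_mul]
  refine (norm_sub_le _ _).trans ?_
  rw [norm_pow, he]
  norm_num

theorem norm_sum_Ico_zpow_le {e : ℂ} (he : ‖e‖ = 1) (a : ℤ) {ℓ : ℤ} (hl : 0 ≤ ℓ) :
    ‖∑ k ∈ Finset.Ico a (a + ℓ), e ^ k‖ ≤ ℓ := by
  refine (norm_sum_le _ _).trans ?_
  simp only [norm_zpow, he, one_zpow, Finset.sum_const, Int.card_Ico, add_sub_cancel_left,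
    nsmul_eq_mul, mul_one]
  rw [← Int.cast_natCast, Int.toNat_of_nonneg hl]

/-- The averages of a nontrivial character over growing boxes tend to zero. -/
theorem tendsto_average_character {e : Fin n → ℂ} (he : ∀ j, ‖e j‖ = 1) {j : Fin n}
    (hj : e j ≠ 1) :
    Tendsto (fun P : NonemptyFinset n => (P.1.card : ℂ)⁻¹ * ∑ x ∈ P.1, ∏ i, e i ^ x i)
      (boxFilter n) (𝓝 0) := by
  have hd : 0 < ‖e j - 1‖ := norm_pos_iff.2 (sub_ne_zero.2 hj)
  rw [(hasBasis_boxFilter n).tendsto_iff Metric.nhds_basis_ball]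
  intro ε hε
  obtain ⟨N, hN⟩ := exists_nat_gt (2 / ‖e j - 1‖ / ε)
  refine ⟨⟨N + 1, N.succ_pos⟩, trivial, ?_⟩
  rintro ⟨P, hP⟩ ⟨a, ℓ, hl, rfl : P = box a ℓ⟩
  simp only [PNat.mk_coe] at hl
  have hl0 : ∀ k, (0 : ℝ) < ℓ k := fun k => by
    have := hl k
    have : 0 < ℓ k := by lia
    exact_mod_cast this
  have hcard : ((box a ℓ).card : ℝ) = ∏ k, (ℓ k : ℝ) := by
    simp only [box, Fintype.card_piFinset, Int.card_Ico, add_sub_cancel_left, Nat.cast_prod]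
    refine Finset.prod_congr rfl fun k _ => ?_
    rw [← Int.cast_natCast, Int.toNat_of_nonneg]
    exact_mod_cast (hl0 k).le
  change ((box a ℓ).card : ℂ)⁻¹ * ∑ x ∈ box a ℓ, ∏ i, e i ^ x i ∈ _
  rw [mem_ball_zero_iff, norm_mul, norm_inv, Complex.norm_natCast, hcard]
  unfold box
  rw [← Finset.prod_univ_sum (fun k => Finset.Ico (a k) (a k + ℓ k)) (fun i y => e i ^ y), norm_prod,
    ← Finset.prod_inv_distrib,
    ← Finset.prod_mul_distrib, ← Finset.mul_prod_erase _ _ (Finset.mem_univ j)]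
  have hrest : ∏ x ∈ Finset.univ.erase j,
      (ℓ x : ℝ)⁻¹ * ‖∑ y ∈ Finset.Ico (a x) (a x + ℓ x), e x ^ y‖ ≤ 1 := by
    refine Finset.prod_le_one (fun k _ => by have := hl0 k; positivity) fun k _ => ?_
    rw [inv_mul_le_one₀ (hl0 k)]
    exact norm_sum_Ico_zpow_le (he k) _ (by exact_mod_cast (hl0 k).le)
  have hfac : (ℓ j : ℝ)⁻¹ * ‖∑ y ∈ Finset.Ico (a j) (a j + ℓ j), e j ^ y‖ < ε := by
    rw [inv_mul_lt_iff₀ (hl0 j)]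
    have h1 := (le_div_iff₀ hd).2 (norm_sum_Ico_zpow_mul_le (he j) (a j) (ℓ j))
    have h2 : (N : ℝ) + 1 ≤ ℓ j := by exact_mod_cast hl j
    rw [div_lt_iff₀ hε] at hN
    nlinarith
  refine lt_of_le_of_lt (mul_le_of_le_one_right ?_ hrest) hfac
  have := hl0 j
  positivity

/-- The image in the torus of a point of the space. -/
def torusMk {d : Type*} (u : d → ℝ) : d → UnitAddCircle := fun i => (u i : UnitAddCircle)

/-- The uniform distribution over the image of a nonempty finite set. -/
def empiricalMeasure {Ω : Type*} [MeasurableSpace Ω] (θ : (Fin n → ℤ) → Ω)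
    (P : NonemptyFinset n) : ProbabilityMeasure Ω :=
  ⟨(P.1.card : ENNReal)⁻¹ • ∑ x ∈ P.1, Measure.dirac (θ x), ⟨by
    simp only [Measure.smul_apply, Measure.coe_finsetSum, Finset.sum_apply, measure_univ,
      Finset.sum_const, smul_eq_mul, nsmul_eq_mul, mul_one]
    exact ENNReal.inv_mul_cancel (by simp [P.2.ne_empty]) (by simp)⟩⟩

theorem integral_empiricalMeasure {Ω : Type*} [MeasurableSpace Ω] [MeasurableSingletonClass Ω]
    (θ : (Fin n → ℤ) → Ω) (P : NonemptyFinset n) (f : Ω → ℂ) :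
    ∫ ω, f ω ∂(empiricalMeasure θ P : Measure Ω) = (P.1.card : ℂ)⁻¹ * ∑ x ∈ P.1, f (θ x) := by
  simp only [empiricalMeasure, ProbabilityMeasure.coe_mk]
  rw [integral_smul_measure, integral_finsetSum_measure fun _ _ => integrable_dirac (by simp)]
  simp

theorem empiricalMeasure_apply {Ω : Type*} [MeasurableSpace Ω] [MeasurableSingletonClass Ω]
    (θ : (Fin n → ℤ) → Ω) (P : NonemptyFinset n) (E : Set Ω) :
    ((empiricalMeasure θ P : Measure Ω) E).toReal
      = windowAverage ((θ ⁻¹' E).indicator fun _ => 1) P.1 := by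
  simp only [empiricalMeasure, ProbabilityMeasure.coe_mk, windowAverage, Measure.smul_apply,
    Measure.coe_finsetSum, Finset.sum_apply, smul_eq_mul, ENNReal.toReal_mul]
  rw [ENNReal.toReal_sum fun x _ => measure_ne_top _ _, div_eq_inv_mul]
  simp only [Measure.dirac_apply, ENNReal.toReal_inv, ENNReal.toReal_natCast]
  congr 2 with x
  by_cases h : θ x ∈ E <;> simp [h]

section Weyl

instance : IsProbabilityMeasure (volume : Measure UnitAddCircle) :=
  ⟨UnitAddCircle.measure_univ⟩

variable {d : Type*} [Fintype d]

theorem mFourier_torusMk (q : d → ℤ) (u : d → ℝ) :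
    UnitAddTorus.mFourier q (torusMk u) =
      Complex.exp (2 * Real.pi * Complex.I * ((∑ i, (q i : ℝ) * u i : ℝ) : ℂ)) := by
  simp only [UnitAddTorus.mFourier, ContinuousMap.coe_mk, torusMk, fourier_coe_apply]
  rw [← Complex.exp_sum]
  push_cast
  rw [Finset.mul_sum]
  congr 1
  refine Finset.sum_congr rfl fun i _ => ?_
  ring

theorem mFourier_torusMk_mulVec (q : d → ℤ) (Λ : Matrix d (Fin n) ℝ) (x : Fin n → ℤ) :
    UnitAddTorus.mFourier q (torusMk (Λ.mulVec (latticeCoe x))) =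
      ∏ j, Complex.exp (2 * Real.pi * Complex.I * ((∑ i, (q i : ℝ) * Λ i j : ℝ) : ℂ)) ^ x j := by
  rw [mFourier_torusMk]
  simp only [← Complex.exp_int_mul]
  rw [← Complex.exp_sum]
  congr 1
  simp only [Matrix.mulVec, dotProduct, latticeCoe]
  push_cast
  simp only [Finset.mul_sum]
  rw [Finset.sum_comm]
  refine Finset.sum_congr rfl fun i _ => Finset.sum_congr rfl fun j _ => ?_
  ring

theorem Nonresonant.exists_forall_sum_ne {Λ : Matrix d (Fin n) ℝ} (h : Nonresonant Λ)
    {q : d → ℤ} (hq : q ≠ 0) : ∃ j, ∀ m : ℤ, ∑ i, (q i : ℝ) * Λ i j ≠ m := by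
  by_contra! hcon
  choose m hm using hcon
  unfold Nonresonant at h
  rw [Fintype.linearIndependent_iff] at h
  apply hq
  funext i
  have := h (Sum.elim (fun j => -(m j : ℚ)) fun i => (q i : ℚ)) ?_ (Sum.inr i)
  · simpa using this
  · funext j
    simp [Fintype.sum_sum_type, Finset.sum_apply, Matrix.row, Matrix.one_apply, Rat.smul_def, hm]

theorem integral_mFourier_eq_zero {q : d → ℤ} (hq : q ≠ 0) :
    ∫ t : d → UnitAddCircle, UnitAddTorus.mFourier q t = 0 := by
  obtain ⟨i, hi⟩ := Function.ne_iff.1 hq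
  classical
  have hv : ∃ v : d → ℝ, ∑ k, (q k : ℝ) * v k = 1 / 2 := by
    refine ⟨Pi.single i (1 / (2 * q i)), ?_⟩
    have : (q i : ℝ) ≠ 0 := by exact_mod_cast hi
    rw [Finset.sum_eq_single i (by intro b _ hb; simp [hb]) (by simp)]
    simp
    field_simp
  obtain ⟨v, hv⟩ := hv
  have hneg : UnitAddTorus.mFourier q (torusMk v) = -1 := by
    rw [mFourier_torusMk, hv, ← Complex.exp_pi_mul_I]
    congr 1
    push_cast
    ring
  have hadd : ∀ s t : d → UnitAddCircle, UnitAddTorus.mFourier q (s + t) =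
      UnitAddTorus.mFourier q s * UnitAddTorus.mFourier q t := by
    intro s t
    simp [UnitAddTorus.mFourier, Finset.prod_mul_distrib, fourier_apply, AddCircle.toCircle_add]
  have key := integral_add_left_eq_self (μ := (volume : Measure (d → UnitAddCircle)))
    (fun t => UnitAddTorus.mFourier q t) (torusMk v)
  simp only [hadd, hneg, integral_const_mul] at key
  linear_combination (-1 / 2 : ℂ) * key

/-- Weyl's theorem: a linear sequence with a nonresonant matrix is equidistributed over boxes. -/
theorem Nonresonant.tendsto_empiricalMeasure {Λ : Matrix d (Fin n) ℝ} (h : Nonresonant Λ) :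
    Tendsto (empiricalMeasure fun x : Fin n → ℤ => torusMk (Λ.mulVec (latticeCoe x)))
      (boxFilter n) (𝓝 (⟨volume, inferInstance⟩ : ProbabilityMeasure (d → UnitAddCircle))) := by
  refine ProbabilityMeasure.tendsto_of_tight_of_separatesPoints ℂ .of_compactSpace
    (A := (UnitAddTorus.mFourierSubalgebra d).comap
      (BoundedContinuousFunction.toContinuousMapStarₐ ℂ)) ?_ ?_
  · intro s t hst
    obtain ⟨_, ⟨f, hf, rfl⟩, hne⟩ := UnitAddTorus.mFourierSubalgebra_separatesPoints hst
    exact ⟨f, ⟨f, ⟨BoundedContinuousFunction.mkOfCompact f, hf, rfl⟩, rfl⟩, hne⟩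
  · intro g hg
    have hspan : BoundedContinuousFunction.toContinuousMapStarₐ ℂ g ∈
        Submodule.span ℂ (Set.range (UnitAddTorus.mFourier (d := d))) := by
      rw [← UnitAddTorus.mFourierSubalgebra_coe]
      exact hg
    have hint : ∀ (f : C(d → UnitAddCircle, ℂ)) (μ : Measure (d → UnitAddCircle))
        [IsProbabilityMeasure μ], Integrable f μ := fun f μ _ =>
      (BoundedContinuousFunction.mkOfCompact f).integrable _
    have key : ∀ f ∈ Submodule.span ℂ (Set.range (UnitAddTorus.mFourier (d := d))),
        Tendsto (fun P => ∫ t, f t ∂(empiricalMeasure (fun x : Fin n → ℤ =>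
          torusMk (Λ.mulVec (latticeCoe x))) P : Measure (d → UnitAddCircle)))
          (boxFilter n) (𝓝 (∫ t : d → UnitAddCircle, f t)) := by
      intro f hf
      induction hf using Submodule.span_induction with
      | mem f hf =>
        obtain ⟨q, rfl⟩ := hf
        by_cases hq : q = 0
        · subst hq
          simpa [UnitAddTorus.mFourier_zero] using tendsto_const_nhds
        · rw [integral_mFourier_eq_zero hq]
          obtain ⟨j, hj⟩ := h.exists_forall_sum_ne hq
          simp only [integral_empiricalMeasure, mFourier_torusMk_mulVec]
          refine tendsto_average_character (fun j => ?_) (j := j) ?_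
          · rw [Complex.norm_exp]
            simp
          · rw [Ne, Complex.exp_eq_one_iff]
            rintro ⟨m, hm⟩
            refine hj m ?_
            rw [mul_comm] at hm
            exact_mod_cast mul_right_cancel₀ Complex.two_pi_I_ne_zero hm
      | zero => simpa using tendsto_const_nhds
      | add f g _ _ hf hg =>
        simp only [ContinuousMap.add_apply]
        have := hf.add hg
        simp only [← integral_add (hint f _) (hint g _)] at this
        exact this
      | smul c f _ hf =>
        simp only [ContinuousMap.smul_apply, integral_smul]
        exact hf.const_smul c
    exact key _ hspan

end Weyl

/-! ### The covering map of the torus -/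

theorem torusMk_eq_torusMk_iff {d : Type*} {u v : d → ℝ} :
    torusMk u = torusMk v ↔ ∃ z : d → ℤ, u = fun i => v i + z i := by
  constructor
  · intro h
    have : ∀ i, ∃ m : ℤ, u i = v i + m := fun i => by
      have hi : ((u i - v i : ℝ) : UnitAddCircle) = 0 := by
        rw [AddCircle.coe_sub, sub_eq_zero]
        exact congrFun h i
      obtain ⟨m, hm⟩ := AddCircle.coe_eq_zero_iff _ |>.1 hi
      exact ⟨m, by simp only [zsmul_eq_mul, mul_one] at hm; linarith⟩
    choose z hz using this
    exact ⟨z, funext hz⟩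
  · rintro ⟨z, rfl⟩
    funext i
    simp only [torusMk, AddCircle.coe_add]
    have : ((z i : ℝ) : UnitAddCircle) = 0 := (AddCircle.coe_eq_zero_iff _).2 ⟨z i, by simp⟩
    rw [this, add_zero]

/-- The image in the product of tori of a finite sequence of points of the space. -/
def torusSeqMk {N : ℕ} (y : Fin N → Fin n → ℝ) : Fin N → Fin n → UnitAddCircle :=
  fun k => torusMk (y k)

theorem continuous_torusMk {d : Type*} : Continuous (torusMk (d := d)) :=
  continuous_pi fun i => (AddCircle.continuous_mk' 1).comp (continuous_apply i)

theorem isOpenMap_torusMk {d : Type*} [Finite d] : IsOpenMap (torusMk (d := d)) :=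
  IsOpenMap.piMap (fun _ => QuotientAddGroup.isOpenMap_coe) (by simp [QuotientAddGroup.mk_surjective])

theorem continuous_torusSeqMk {N : ℕ} : Continuous (torusSeqMk (n := n) (N := N)) :=
  continuous_pi fun k => continuous_torusMk.comp (continuous_apply k)

theorem isOpenMap_torusSeqMk {N : ℕ} : IsOpenMap (torusSeqMk (n := n) (N := N)) :=
  IsOpenMap.piMap (fun _ => isOpenMap_torusMk) (by simp)

theorem measurePreserving_torusMk (d : Type*) [Fintype d] :
    MeasurePreserving (torusMk (d := d))
      (volume.restrict (Set.univ.pi fun _ => Set.Ioc 0 1)) volume := by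
  have h := measurePreserving_pi (fun _ : d => (volume : Measure ℝ).restrict (Set.Ioc 0 1))
    (fun _ : d => (volume : Measure UnitAddCircle))
    (fun _ => by simpa using UnitAddCircle.measurePreserving_mk 0)
  rw [← Measure.restrict_pi_pi] at h
  exact h

theorem measurePreserving_torusSeqMk (n N : ℕ) :
    MeasurePreserving (torusSeqMk (n := n) (N := N))
      (volume.restrict (Set.univ.pi fun _ => Set.univ.pi fun _ => Set.Ioc 0 1)) volume := by
  have h := measurePreserving_pi
    (fun _ : Fin N => (volume : Measure (Fin n → ℝ)).restrict (Set.univ.pi fun _ => Set.Ioc 0 1))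
    (fun _ => volume) (fun _ => measurePreserving_torusMk (Fin n))
  rw [← Measure.restrict_pi_pi] at h
  exact h

theorem volume_image_torusSeqMk_eq_zero {N : ℕ} {Z : Set (Fin N → Fin n → ℝ)}
    (hZ : IsCompact Z) (h0 : volume Z = 0) : volume (torusSeqMk '' Z) = 0 := by
  rw [← (measurePreserving_torusSeqMk n N).measure_preimage
    (hZ.image continuous_torusSeqMk).isClosed.measurableSet.nullMeasurableSet]
  refine Measure.absolutelyContinuous_of_le Measure.restrict_le_self ?_
  refine measure_mono_null (t := ⋃ z : Fin N → Fin n → ℤ,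
    (fun y => y + fun k => latticeCoe (z k)) ⁻¹' Z) ?_ (measure_iUnion_null fun z => ?_)
  · rintro y ⟨w, hw, hwy⟩
    have : ∀ k, ∃ z : Fin n → ℤ, w k = fun i => y k i + z i := fun k =>
      torusMk_eq_torusMk_iff.1 (congrFun hwy k)
    choose z hz using this
    refine Set.mem_iUnion.2 ⟨z, ?_⟩
    have hwz : w = y + fun k => latticeCoe (z k) := funext hz
    exact (congrArg (· ∈ Z) hwz).mp hw
  · rw [measure_preimage_add_right, h0]

theorem volume_frontier_image_torusSeqMk {N : ℕ} {Y : Set (Fin N → Fin n → ℝ)}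
    (hY : IsCompact (closure Y)) (h0 : volume (frontier Y) = 0) :
    volume (frontier (torusSeqMk '' Y)) = 0 := by
  refine measure_mono_null ?_ (volume_image_torusSeqMk_eq_zero
    (hY.of_isClosed_subset isClosed_frontier frontier_subset_closure) h0)
  have hcl : closure (torusSeqMk '' Y) ⊆ torusSeqMk '' closure Y :=
    closure_minimal (Set.image_mono subset_closure) (hY.image continuous_torusSeqMk).isClosed
  have hint : torusSeqMk '' interior Y ⊆ interior (torusSeqMk '' Y) :=
    interior_maximal (Set.image_mono interior_subset) (isOpenMap_torusSeqMk _ isOpen_interior)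
  rintro t ⟨ht, ht'⟩
  obtain ⟨y, hy, rfl⟩ := hcl ht
  exact ⟨y, ⟨hy, fun hy' => ht' (hint ⟨y, hy', rfl⟩)⟩, rfl⟩

/-! ### Backward paths of the quantized system -/

/-- The sequences `y₀, …, y_{N-1}` with `L y₀ - a ∈ G` and `L y_{k+1} - y_k ∈ G`. -/
def pathSet (G : Set (Fin n → ℝ)) (L : Matrix (Fin n) (Fin n) ℝ) (N : ℕ) (a : Fin n → ℝ) :
    Set (Fin N → Fin n → ℝ) :=
  {y | ∀ k : Fin N, L.mulVec (y k) - (Fin.cons a y : Fin (N + 1) → Fin n → ℝ) k.castSucc ∈ G}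

theorem cons_add_apply {N : ℕ} (a b : Fin n → ℝ) (y z : Fin N → Fin n → ℝ)
    (k : Fin (N + 1)) :
    (Fin.cons (a + b) (y + z) : Fin (N + 1) → Fin n → ℝ) k =
      (Fin.cons a y : Fin (N + 1) → Fin n → ℝ) k +
        (Fin.cons b z : Fin (N + 1) → Fin n → ℝ) k := by
  cases k using Fin.cases <;> simp

theorem cons_smul_apply {N : ℕ} (c : ℝ) (y : Fin N → Fin n → ℝ) (k : Fin (N + 1)) :
    (Fin.cons 0 (c • y) : Fin (N + 1) → Fin n → ℝ) k =
      c • (Fin.cons 0 y : Fin (N + 1) → Fin n → ℝ) k := by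
  cases k using Fin.cases <;> simp

/-- The linear map `y ↦ (L y₀, L y₁ - y₀, …)`. -/
def incrementMap (L : Matrix (Fin n) (Fin n) ℝ) (N : ℕ) :
    (Fin N → Fin n → ℝ) →ₗ[ℝ] (Fin N → Fin n → ℝ) where
  toFun y k := L.mulVec (y k) - (Fin.cons 0 y : Fin (N + 1) → Fin n → ℝ) k.castSucc
  map_add' y z := by
    funext k
    have := cons_add_apply 0 0 y z k.castSucc
    rw [add_zero] at this
    rw [this, Pi.add_apply, Pi.add_apply, Matrix.mulVec_add]
    abel
  map_smul' c y := by
    funext k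
    rw [cons_smul_apply]
    simp [Matrix.mulVec_smul, smul_sub]

theorem mulVec_injective {L : Matrix (Fin n) (Fin n) ℝ} (hL : IsUnit L.det) :
    Function.Injective L.mulVec :=
  Matrix.mulVec_injective_iff_isUnit.2 ((Matrix.isUnit_iff_isUnit_det L).2 hL)

theorem incrementMap_injective {L : Matrix (Fin n) (Fin n) ℝ} (hL : IsUnit L.det) (N : ℕ) :
    Function.Injective (incrementMap L N) := by
  refine (injective_iff_map_eq_zero _).2 fun y hy => ?_
  have key : ∀ i : Fin (N + 1), (Fin.cons 0 y : Fin (N + 1) → Fin n → ℝ) i = 0 := by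
    intro i
    induction i using Fin.induction with
    | zero => rfl
    | succ k ih =>
      have hk : L.mulVec (y k) - (Fin.cons 0 y : Fin (N + 1) → Fin n → ℝ) k.castSucc = 0 :=
        congrFun hy k
      rw [ih, sub_zero] at hk
      exact mulVec_injective hL (hk.trans (Matrix.mulVec_zero L).symm)
  funext k
  exact key k.succ

/-- The invertible linear map `y ↦ (L y₀, L y₁ - y₀, …)`. -/
def incrementEquiv {L : Matrix (Fin n) (Fin n) ℝ} (hL : IsUnit L.det) (N : ℕ) :
    (Fin N → Fin n → ℝ) ≃L[ℝ] (Fin N → Fin n → ℝ) :=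
  (LinearEquiv.ofInjectiveEndo _ (incrementMap_injective hL N)).toContinuousLinearEquiv

theorem pathSet_eq_preimage (G : Set (Fin n → ℝ)) {L : Matrix (Fin n) (Fin n) ℝ}
    (hL : IsUnit L.det) (N : ℕ) (a : Fin n → ℝ) :
    pathSet G L N a = incrementEquiv hL N ⁻¹'
      ((fun y => y + -fun k : Fin N => (Fin.cons a 0 : Fin (N + 1) → Fin n → ℝ) k.castSucc) ⁻¹'
        Set.univ.pi fun _ => G) := by
  ext y
  simp only [pathSet, Set.mem_ofPred_eq, Set.mem_preimage, Set.mem_univ_pi]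
  refine forall_congr' fun k => ?_
  have h := cons_add_apply 0 a y 0 k.castSucc
  rw [zero_add, add_zero] at h
  rw [h, ← sub_sub, sub_eq_add_neg _ ((Fin.cons a 0 : Fin (N + 1) → Fin n → ℝ) k.castSucc)]
  rfl

theorem volume_frontier_univ_pi {G : Set (Fin n → ℝ)} (hG : volume (frontier G) = 0) (N : ℕ) :
    volume (frontier (Set.univ.pi fun _ : Fin N => G)) = 0 := by
  rw [frontier, closure_pi_set, interior_pi_set Set.finite_univ]
  refine ae_le_set.1 (Measure.ae_eq_set_pi fun _ _ => ?_).le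
  exact (closure_ae_eq_of_null_frontier hG).trans (interior_ae_eq_of_null_frontier hG).symm

theorem isCompact_closure_pathSet {G : Set (Fin n → ℝ)} (hG : Bornology.IsBounded G)
    {L : Matrix (Fin n) (Fin n) ℝ} (hL : IsUnit L.det) (N : ℕ) (a : Fin n → ℝ) :
    IsCompact (closure (pathSet G L N a)) := by
  rw [pathSet_eq_preimage G hL, ← ContinuousLinearEquiv.coe_toHomeomorph,
    ← Homeomorph.preimage_closure, Homeomorph.isCompact_preimage, ← Homeomorph.coe_addRight,
    ← Homeomorph.preimage_closure, Homeomorph.isCompact_preimage, closure_pi_set]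
  exact isCompact_univ_pi fun _ => hG.isCompact_closure

theorem volume_frontier_pathSet {G : Set (Fin n → ℝ)} (hG : volume (frontier G) = 0)
    {L : Matrix (Fin n) (Fin n) ℝ} (hL : IsUnit L.det) (N : ℕ) (a : Fin n → ℝ) :
    volume (frontier (pathSet G L N a)) = 0 := by
  rw [pathSet_eq_preimage G hL, ← ContinuousLinearEquiv.coe_toHomeomorph,
    ← Homeomorph.preimage_frontier, ContinuousLinearEquiv.coe_toHomeomorph,
    Measure.addHaar_preimage_continuousLinearEquiv, ← Homeomorph.coe_addRight,
    ← Homeomorph.preimage_frontier, Homeomorph.coe_addRight, measure_preimage_add_right,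
    volume_frontier_univ_pi hG, mul_zero]

/-- The residues modulo the lattice of the backward paths which start at `a`. -/
def pathResidues (G : Set (Fin n → ℝ)) (L : Matrix (Fin n) (Fin n) ℝ) (N : ℕ)
    (a : Fin n → ℝ) : Set (Fin N → Fin n → UnitAddCircle) :=
  torusSeqMk '' pathSet G L N a

theorem volume_frontier_pathResidues {G : Set (Fin n → ℝ)} (hG : JordanMeasurable G)
    {L : Matrix (Fin n) (Fin n) ℝ} (hL : IsUnit L.det) (N : ℕ) (a : Fin n → ℝ) :
    volume (frontier (pathResidues G L N a)) = 0 :=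
  volume_frontier_image_torusSeqMk (isCompact_closure_pathSet hG.1 hL N a)
    (volume_frontier_pathSet hG.2 hL N a)

theorem pathResidues_zero (G : Set (Fin n → ℝ)) (L : Matrix (Fin n) (Fin n) ℝ)
    (a : Fin n → ℝ) : pathResidues G L 0 a = Set.univ :=
  Set.eq_univ_of_forall fun _ => ⟨Fin.elim0, fun k => k.elim0, Subsingleton.elim _ _⟩

theorem cons_mem_pathResidues_iff {G : Set (Fin n → ℝ)} {L : Matrix (Fin n) (Fin n) ℝ} {N : ℕ}
    {a : Fin n → ℝ} {t : Fin n → UnitAddCircle} {θ : Fin N → Fin n → UnitAddCircle} :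
    (Fin.cons t θ : Fin (N + 1) → Fin n → UnitAddCircle) ∈ pathResidues G L (N + 1) a ↔
      ∃ y : Fin n → ℝ, torusMk y = t ∧ L.mulVec y - a ∈ G ∧ θ ∈ pathResidues G L N y := by
  constructor
  · rintro ⟨y, hy, hyt⟩
    refine ⟨y 0, congrFun hyt 0, hy 0, Fin.tail y, fun k => ?_, ?_⟩
    · have := hy k.succ
      rw [Fin.castSucc_succ, Fin.cons_succ] at this
      rwa [Fin.cons_self_tail]
    · funext k
      exact congrFun hyt k.succ
  · rintro ⟨y, rfl, hy, w, hw, rfl⟩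
    refine ⟨Fin.cons y w, fun k => ?_, ?_⟩
    · cases k using Fin.cases with
      | zero => simpa using hy
      | succ k => simpa [Fin.castSucc_succ] using hw k
    · funext k
      cases k using Fin.cases <;> rfl

/-- The displacements `L⁻¹ c, L⁻² c, …` of a backward path when its start is moved by `c`. -/
def backwardOrbit (L : Matrix (Fin n) (Fin n) ℝ) (N : ℕ) (c : Fin n → ℝ) :
    Fin N → Fin n → ℝ :=
  fun k => (L⁻¹ ^ (k.1 + 1)).mulVec c

theorem mulVec_backwardOrbit {L : Matrix (Fin n) (Fin n) ℝ} (hL : IsUnit L.det) (N : ℕ)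
    (c : Fin n → ℝ) (k : Fin N) :
    L.mulVec (backwardOrbit L N c k) =
      (Fin.cons c (backwardOrbit L N c) : Fin (N + 1) → Fin n → ℝ) k.castSucc := by
  have h1 : L.mulVec (backwardOrbit L N c k) = (L⁻¹ ^ k.1).mulVec c := by
    rw [backwardOrbit, Matrix.mulVec_mulVec, pow_succ', ← mul_assoc, Matrix.mul_nonsing_inv L hL,
      one_mul]
  rw [h1]
  obtain ⟨k, hk⟩ := k
  cases k with
  | zero => simp
  | succ k =>
    have : (⟨k + 1, hk⟩ : Fin N).castSucc = Fin.succ ⟨k, by lia⟩ := rfl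
    rw [this, Fin.cons_succ]
    rfl

theorem add_mem_pathSet_iff {G : Set (Fin n → ℝ)} {L : Matrix (Fin n) (Fin n) ℝ}
    (hL : IsUnit L.det) {N : ℕ} {a c : Fin n → ℝ} {y : Fin N → Fin n → ℝ} :
    y + backwardOrbit L N c ∈ pathSet G L N (a + c) ↔ y ∈ pathSet G L N a := by
  refine forall_congr' fun k => ?_
  rw [cons_add_apply, Pi.add_apply, Matrix.mulVec_add, mulVec_backwardOrbit hL,
    add_sub_add_right_eq_sub]

theorem torusSeqMk_add {N : ℕ} (y z : Fin N → Fin n → ℝ) :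
    torusSeqMk (y + z) = torusSeqMk y + torusSeqMk z := rfl

theorem add_mem_pathResidues_iff {G : Set (Fin n → ℝ)} {L : Matrix (Fin n) (Fin n) ℝ}
    (hL : IsUnit L.det) {N : ℕ} {a c : Fin n → ℝ} {θ : Fin N → Fin n → UnitAddCircle} :
    θ + torusSeqMk (backwardOrbit L N c) ∈ pathResidues G L N (a + c) ↔
      θ ∈ pathResidues G L N a := by
  constructor
  · rintro ⟨y, hy, hyt⟩
    refine ⟨y - backwardOrbit L N c, ?_, ?_⟩
    · rwa [← add_mem_pathSet_iff hL (c := c), sub_add_cancel]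
    · rw [← add_right_cancel_iff (a := torusSeqMk (backwardOrbit L N c)), ← hyt,
        ← torusSeqMk_add, sub_add_cancel]
  · rintro ⟨y, hy, rfl⟩
    exact ⟨_, (add_mem_pathSet_iff hL).2 hy, rfl⟩

/-! ### Reachable points -/

theorem IsQuantizer.eq_iff {R : (Fin n → ℝ) → (Fin n → ℤ)} (hR : IsQuantizer R)
    (u : Fin n → ℝ) (z : Fin n → ℤ) : R u = z ↔ u - latticeCoe z ∈ R ⁻¹' {0} := by
  have := hR.map_add_lattice (u - latticeCoe z) z
  rw [sub_add_cancel] at this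
  rw [this, Set.mem_preimage, Set.mem_singleton_iff, add_eq_right]

theorem mem_reachable_iff {R : (Fin n → ℝ) → (Fin n → ℤ)} (hR : IsQuantizer R)
    (L : Matrix (Fin n) (Fin n) ℝ) (N : ℕ) (x : Fin n → ℤ) :
    x ∈ reachable R L N ↔
      (0 : Fin N → Fin n → UnitAddCircle) ∈ pathResidues (R ⁻¹' {0}) L N (latticeCoe x) := by
  induction N generalizing x with
  | zero => simp [pathResidues_zero, reachable]
  | succ N ih =>
    have h0 : (0 : Fin (N + 1) → Fin n → UnitAddCircle) = Fin.cons 0 0 := by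
      funext k
      cases k using Fin.cases <;> rfl
    have h1 : x ∈ reachable R L (N + 1) ↔ ∃ z ∈ reachable R L N, transition R L z = x := by
      simp [reachable, Function.iterate_succ_apply']
    rw [h1, h0, cons_mem_pathResidues_iff]
    constructor
    · rintro ⟨z, hz, hzx⟩
      refine ⟨latticeCoe z, ?_, (hR.eq_iff _ _).1 hzx, (ih z).1 hz⟩
      exact (torusMk_eq_torusMk_iff (v := 0)).2 ⟨z, by funext i; simp [latticeCoe]⟩
    · rintro ⟨y, hy, hyx, hres⟩
      obtain ⟨z, rfl⟩ := (torusMk_eq_torusMk_iff (v := 0)).1 hy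
      have hz : (fun i => (0 : Fin n → ℝ) i + (z i : ℝ)) = latticeCoe z := by
        funext i
        simp [latticeCoe]
      rw [hz] at hyx hres
      exact ⟨z, (ih z).2 hres, (hR.eq_iff _ _).2 hyx⟩

theorem reachable_eq_preimage {R : (Fin n → ℝ) → (Fin n → ℤ)} (hR : IsQuantizer R)
    {L : Matrix (Fin n) (Fin n) ℝ} (hL : IsUnit L.det) (N : ℕ) :
    reachable R L N = (fun x => torusSeqMk (-backwardOrbit L N (latticeCoe x))) ⁻¹'
      pathResidues (R ⁻¹' {0}) L N 0 := by
  ext x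
  have h0 : torusSeqMk (-backwardOrbit L N (latticeCoe x)) +
      torusSeqMk (backwardOrbit L N (latticeCoe x)) = 0 := by
    rw [← torusSeqMk_add, neg_add_cancel]
    rfl
  have h := add_mem_pathResidues_iff (G := R ⁻¹' {0}) hL (a := 0) (c := latticeCoe x)
    (θ := torusSeqMk (-backwardOrbit L N (latticeCoe x)))
  rw [h0, zero_add] at h
  rw [mem_reachable_iff hR]
  exact h

instance (N n : ℕ) : BorelSpace (Fin N → Fin n → UnitAddCircle) := Pi.borelSpace

instance (N n : ℕ) :
    Measure.IsAddHaarMeasure (volume : Measure (Fin N → Fin n → UnitAddCircle)) :=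
  Measure.pi.isAddHaarMeasure _

instance (n : ℕ) : Measure.IsNegInvariant (volume : Measure (Fin n → UnitAddCircle)) :=
  Measure.pi.isNegInvariant _

/-! ### Frequencies of the sets of reachable points -/

theorem Nonresonant.neg {ι : Type*} {Λ : Matrix ι (Fin n) ℝ} (h : Nonresonant Λ) :
    Nonresonant (-Λ) := by
  have := LinearIndependent.units_smul h (Sum.elim (fun _ => 1) fun _ => -1)
  unfold Nonresonant
  convert this using 1
  funext k
  cases k with
  | inl k => exact (one_smul ℚˣ _).symm
  | inr k => exact ((Units.neg_smul (1 : ℚˣ) (Λ k)).trans (by rw [one_smul]; rfl)).symm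

/-- The matrix formed by stacking `L⁻¹, L⁻², …, L⁻ᴺ`. -/
def stackedInversePowers (L : Matrix (Fin n) (Fin n) ℝ) (N : ℕ) :
    Matrix (Fin N × Fin n) (Fin n) ℝ :=
  Matrix.of fun p j => (L⁻¹ ^ (p.1.1 + 1)) p.2 j

theorem IterativelyNonresonant.nonresonant_stackedInversePowers {L : Matrix (Fin n) (Fin n) ℝ}
    (hL : IterativelyNonresonant L) (N : ℕ) : Nonresonant (stackedInversePowers L N) := by
  let e := Fintype.equivFin (Fin N × Fin n)
  let g : Fin N × Fin n ↪ {k : ℤ // k ≠ 0} × Fin n :=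
    ⟨fun p => (⟨-((p.1.1 + 1 : ℕ) : ℤ), by lia⟩, p.2), by
      rintro ⟨k, i⟩ ⟨k', i'⟩ h
      simp only [Prod.mk.injEq, Subtype.mk.injEq] at h
      ext
      · lia
      · simp [h.2]⟩
  have h := hL.2 _ (e.symm.toEmbedding.trans g)
  have h' := LinearIndependent.comp h (Sum.map id e)
    (Sum.map_injective.2 ⟨fun _ _ h => h, e.injective⟩)
  unfold Nonresonant
  convert h' using 1
  funext k j
  cases k with
  | inl k => rfl
  | inr k =>
    have hg : (L ^ ((g k).1 : ℤ)) = L⁻¹ ^ (k.1.1 + 1) := by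
      rw [Matrix.inv_pow']
      exact Matrix.zpow_neg_natCast L _
    change _ = (L ^ ((g (e.symm (e k))).1 : ℤ)) (g (e.symm (e k))).2 j
    rw [Equiv.symm_apply_apply, hg]
    rfl

/-- Currying, as a homeomorphism from the torus of dimension `N n` to a product of tori. -/
def curryTorus (N n : ℕ) :
    (Fin N × Fin n → UnitAddCircle) ≃ₜ (Fin N → Fin n → UnitAddCircle) where
  toEquiv := Equiv.curry _ _ _
  continuous_toFun := continuous_pi fun k => continuous_pi fun i => continuous_apply (k, i)
  continuous_invFun := continuous_pi fun p => (continuous_apply p.2).comp (continuous_apply p.1)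

theorem measurePreserving_curryTorus (N n : ℕ) : MeasurePreserving (curryTorus N n) := by
  let f : (Fin N × Fin n → UnitAddCircle) →+ (Fin N → Fin n → UnitAddCircle) :=
    { toFun := curryTorus N n
      map_zero' := rfl
      map_add' := fun _ _ => rfl }
  exact f.measurePreserving (curryTorus N n).continuous (curryTorus N n).surjective
    (by rw [measure_univ, measure_univ])

theorem hasFrequency_reachable {R : (Fin n → ℝ) → (Fin n → ℤ)} (hR : IsQuantizer R)
    {L : Matrix (Fin n) (Fin n) ℝ} (hL : IterativelyNonresonant L) (N : ℕ) :
    HasFrequency (reachable R L N) (volume (pathResidues (R ⁻¹' {0}) L N 0)).toReal := by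
  set E := pathResidues (R ⁻¹' {0}) L N 0
  have hE : volume (frontier E) = 0 :=
    volume_frontier_pathResidues hR.jordanMeasurable_cell hL.1 N 0
  have hmp := measurePreserving_curryTorus N n
  apply hasFrequency_of_tendsto
  have hlim := ProbabilityMeasure.tendsto_measure_of_null_frontier_of_tendsto'
    (hL.nonresonant_stackedInversePowers N).neg.tendsto_empiricalMeasure
    (E := curryTorus N n ⁻¹' E) (by
      rw [← Homeomorph.preimage_frontier]
      exact (hmp.measure_preimage isClosed_frontier.measurableSet.nullMeasurableSet).trans hE)
  have hvol : volume (curryTorus N n ⁻¹' E) = volume E :=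
    hmp.measure_preimage (nullMeasurableSet_of_null_frontier hE)
  have hlim' := (ENNReal.tendsto_toReal (hvol ▸ measure_ne_top _ _)).comp hlim
  rw [ProbabilityMeasure.coe_mk, hvol] at hlim'
  refine hlim'.congr fun P => ?_
  rw [Function.comp_apply, empiricalMeasure_apply, reachable_eq_preimage hR hL.1]
  have : ∀ x, curryTorus N n (torusMk ((-stackedInversePowers L N).mulVec (latticeCoe x))) =
      torusSeqMk (-backwardOrbit L N (latticeCoe x)) := fun x => by
    rw [Matrix.neg_mulVec]
    rfl
  simp only [← this]
  rfl

/-! ### The fundamental domain formed by the cell of a quantizer -/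

theorem exists_mem_span_eq_latticeCoe
    (g : (Submodule.span ℤ (Set.range (Pi.basisFun ℝ (Fin n)))).toAddSubgroup) :
    ∃ z : Fin n → ℤ, (g : Fin n → ℝ) = latticeCoe z := by
  have := ((Pi.basisFun ℝ (Fin n)).mem_span_iff_repr_mem ℤ g.1).1 g.2
  choose z hz using this
  exact ⟨z, funext fun i => by simpa [latticeCoe] using (hz i).symm⟩

theorem latticeCoe_mem_span (z : Fin n → ℤ) :
    latticeCoe z ∈ Submodule.span ℤ (Set.range (Pi.basisFun ℝ (Fin n))) :=
  ((Pi.basisFun ℝ (Fin n)).mem_span_iff_repr_mem ℤ _).2 fun i => ⟨z i, by simp [latticeCoe]⟩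

theorem IsQuantizer.nullMeasurableSet_cell {R : (Fin n → ℝ) → (Fin n → ℤ)}
    (hR : IsQuantizer R) : NullMeasurableSet (R ⁻¹' {0}) :=
  nullMeasurableSet_of_null_frontier hR.jordanMeasurable_cell.2

theorem IsQuantizer.nullMeasurableSet_compensating_cell {R : (Fin n → ℝ) → (Fin n → ℤ)}
    (hR : IsQuantizer R) (L : Matrix (Fin n) (Fin n) ℝ) :
    NullMeasurableSet (compensatingQuantizer R L ⁻¹' {0}) :=
  hR.nullMeasurableSet_cell.preimage
    (measurePreserving_add_right volume ((1 + L⁻¹).mulVec (cellMean R))).quasiMeasurePreserving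

theorem IsQuantizer.isAddFundamentalDomain {R : (Fin n → ℝ) → (Fin n → ℤ)}
    (hR : IsQuantizer R) (L : Matrix (Fin n) (Fin n) ℝ) :
    IsAddFundamentalDomain (Submodule.span ℤ (Set.range (Pi.basisFun ℝ (Fin n)))).toAddSubgroup
      (compensatingQuantizer R L ⁻¹' {0}) := by
  refine IsAddFundamentalDomain.mk' (hR.nullMeasurableSet_compensating_cell L) fun u => ?_
  have hadd : ∀ z : Fin n → ℤ, compensatingQuantizer R L (latticeCoe z + u) =
      compensatingQuantizer R L u + z := fun z => by
    rw [compensatingQuantizer, compensatingQuantizer, ← hR.map_add_lattice]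
    congr 1
    abel
  refine ⟨⟨_, latticeCoe_mem_span (-compensatingQuantizer R L u)⟩, ?_, fun g hg => ?_⟩
  · change compensatingQuantizer R L (latticeCoe _ + u) = 0
    rw [hadd, add_neg_cancel]
  · obtain ⟨z, hz⟩ := exists_mem_span_eq_latticeCoe g
    have hg' : compensatingQuantizer R L ((g : Fin n → ℝ) + u) = 0 := hg
    rw [hz, hadd] at hg'
    ext1
    rw [hz, eq_neg_of_add_eq_zero_right hg']

theorem IsQuantizer.lintegral_torus {R : (Fin n → ℝ) → (Fin n → ℤ)}
    (hR : IsQuantizer R) (L : Matrix (Fin n) (Fin n) ℝ)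
    {f : (Fin n → UnitAddCircle) → ENNReal} (hf : AEMeasurable f) :
    ∫⁻ t, f t = ∫⁻ u in compensatingQuantizer R L ⁻¹' {0}, f (torusMk (-u)) := by
  have : Countable (Submodule.span ℤ (Set.range (Pi.basisFun ℝ (Fin n)))).toAddSubgroup :=
    inferInstanceAs (Countable (Submodule.span ℤ (Set.range (Pi.basisFun ℝ (Fin n)))))
  have hneg := Measure.measurePreserving_neg (volume : Measure (Fin n → UnitAddCircle))
  have hmp := hneg.comp (measurePreserving_torusMk (Fin n))
  rw [← hmp.map_eq, lintegral_map' (by rw [hmp.map_eq]; exact hf) hmp.aemeasurable,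
    (hR.isAddFundamentalDomain L).setLIntegral_eq (ZSpan.isAddFundamentalDomain' _ _),
    ZSpan.fundamentalDomain_pi_basisFun]
  · exact setLIntegral_congr (Measure.ae_eq_set_pi fun _ _ => Ico_ae_eq_Ioc.symm)
  · intro g u
    obtain ⟨z, hz⟩ := exists_mem_span_eq_latticeCoe g
    congr 1
    refine torusMk_eq_torusMk_iff.2 ⟨-z, ?_⟩
    change -((g : Fin n → ℝ) + u) = _
    rw [hz]
    funext i
    simp [latticeCoe]

/-! ### One step of the chain of sets -/

/-- The residues of the backward paths which start in a set of lattice points. -/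
def latticeResidues (G : Set (Fin n → ℝ)) (L : Matrix (Fin n) (Fin n) ℝ) (N : ℕ)
    (A : Set (Fin n → ℤ)) : Set (Fin N → Fin n → UnitAddCircle) :=
  ⋃ a ∈ A, pathResidues G L N (latticeCoe a)

theorem nullMeasurableSet_latticeResidues {G : Set (Fin n → ℝ)} (hG : JordanMeasurable G)
    {L : Matrix (Fin n) (Fin n) ℝ} (hL : IsUnit L.det) (N : ℕ) (A : Set (Fin n → ℤ)) :
    NullMeasurableSet (latticeResidues G L N A) :=
  .biUnion A.to_countable fun _ _ =>
    nullMeasurableSet_of_null_frontier (volume_frontier_pathResidues hG hL N _)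

theorem eq_add_inv_mulVec_iff {L : Matrix (Fin n) (Fin n) ℝ} (hL : IsUnit L.det)
    (x u w : Fin n → ℝ) : x = u + L⁻¹.mulVec w ↔ L.mulVec (x - u) = w := by
  rw [← sub_eq_iff_eq_add']
  constructor
  · intro h
    rw [h, Matrix.mulVec_mulVec, Matrix.mul_nonsing_inv L hL, Matrix.one_mulVec]
  · rintro rfl
    rw [Matrix.mulVec_mulVec, Matrix.nonsing_inv_mul L hL, Matrix.one_mulVec]

theorem mem_chainStep_iff {R : (Fin n → ℝ) → (Fin n → ℤ)} {L : Matrix (Fin n) (Fin n) ℝ}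
    (hL : IsUnit L.det) {A : Finset (Fin n → ℤ)} {u : Fin n → ℝ} {z : Fin n → ℤ} :
    z ∈ chainStep R L A u ↔
      ∃ a ∈ A, L.mulVec (latticeCoe z - u) - latticeCoe a ∈ R ⁻¹' {0} := by
  simp only [chainStep, Set.mem_ofPred_eq, eq_add_inv_mulVec_iff hL]
  refine exists_congr fun a => and_congr_right fun _ => ?_
  constructor
  · rintro ⟨v, hv, h⟩
    rwa [h, add_sub_cancel_left]
  · exact fun h => ⟨_, h, (add_sub_cancel _ _).symm⟩

theorem volume_slice_latticeResidues (R : (Fin n → ℝ) → (Fin n → ℤ))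
    {L : Matrix (Fin n) (Fin n) ℝ} (hL : IsUnit L.det) (N : ℕ) (A : Finset (Fin n → ℤ))
    (u : Fin n → ℝ) :
    volume {θ : Fin N → Fin n → UnitAddCircle |
        (Fin.cons (torusMk (-u)) θ : Fin (N + 1) → Fin n → UnitAddCircle) ∈
          latticeResidues (R ⁻¹' {0}) L (N + 1) A} =
      volume (latticeResidues (R ⁻¹' {0}) L N (chainStep R L A u)) := by
  rw [← measure_preimage_add_right volume (torusSeqMk (backwardOrbit L N u))
    (latticeResidues (R ⁻¹' {0}) L N (chainStep R L A u))]
  congr 1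
  ext θ
  have hshift : ∀ z : Fin n → ℤ, θ + torusSeqMk (backwardOrbit L N u) ∈
      pathResidues (R ⁻¹' {0}) L N (latticeCoe z) ↔
        θ ∈ pathResidues (R ⁻¹' {0}) L N (latticeCoe z - u) := fun z => by
    rw [← add_mem_pathResidues_iff hL (a := latticeCoe z - u) (c := u), sub_add_cancel]
  simp only [latticeResidues, Set.mem_ofPred_eq, Set.mem_iUnion, Set.mem_preimage, exists_prop,
    mem_chainStep_iff hL, cons_mem_pathResidues_iff, hshift, Finset.mem_coe]
  constructor
  · rintro ⟨a, ha, y, hy, hya, hθ⟩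
    obtain ⟨z, hz⟩ := torusMk_eq_torusMk_iff.1 hy
    have hyz : y = latticeCoe z - u := by
      rw [hz]
      funext i
      simp [latticeCoe]
      ring
    subst hyz
    exact ⟨z, ⟨a, ha, hya⟩, hθ⟩
  · rintro ⟨z, ⟨a, ha, hza⟩, hθ⟩
    refine ⟨a, ha, _, torusMk_eq_torusMk_iff.2 ⟨z, ?_⟩, hza, hθ⟩
    funext i
    simp [latticeCoe]
    ring

theorem aemeasurable_measure_slice {α β : Type*} [MeasurableSpace α] [MeasurableSpace β]
    {μ : Measure α} {ν : Measure β} [SFinite μ] [SFinite ν] {s : Set (α × β)}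
    (hs : NullMeasurableSet s (μ.prod ν)) :
    AEMeasurable (fun x => ν (Prod.mk x ⁻¹' s)) μ ∧
      μ.prod ν s = ∫⁻ x, ν (Prod.mk x ⁻¹' s) ∂μ := by
  obtain ⟨t, ht, hst⟩ := hs
  have hslice : (fun x => ν (Prod.mk x ⁻¹' s)) =ᵐ[μ] fun x => ν (Prod.mk x ⁻¹' t) := by
    filter_upwards [Measure.ae_ae_of_ae_prod hst] with x hx
    exact measure_congr hx
  refine ⟨⟨_, measurable_measure_prodMk_left ht, hslice⟩, ?_⟩
  rw [measure_congr hst, Measure.prod_apply ht]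
  exact lintegral_congr_ae hslice.symm

theorem volume_latticeResidues_succ {R : (Fin n → ℝ) → (Fin n → ℤ)} (hR : IsQuantizer R)
    {L : Matrix (Fin n) (Fin n) ℝ} (hL : IsUnit L.det) (N : ℕ) (A : Finset (Fin n → ℤ)) :
    volume (latticeResidues (R ⁻¹' {0}) L (N + 1) (A : Set (Fin n → ℤ))) =
      ∫⁻ u in compensatingQuantizer R L ⁻¹' {0},
        volume (latticeResidues (R ⁻¹' {0}) L N (chainStep R L A u)) := by
  simp only [← volume_slice_latticeResidues R hL]
  set S := latticeResidues (R ⁻¹' {0}) L (N + 1) (A : Set (Fin n → ℤ))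
  have hS : NullMeasurableSet S :=
    nullMeasurableSet_latticeResidues hR.jordanMeasurable_cell hL _ _
  have hmp := (volume_preserving_piFinSuccAbove (fun _ : Fin (N + 1) => Fin n → UnitAddCircle)
    0).symm
  obtain ⟨hmeas, hint⟩ := aemeasurable_measure_slice (hS.preimage hmp.quasiMeasurePreserving)
  rw [← hmp.measure_preimage hS]
  refine hint.trans ((hR.lintegral_torus L hmeas).trans (lintegral_congr fun u => ?_))
  congr 1
  ext θ
  simp [MeasurableEquiv.piFinSuccAbove, Fin.insertNthEquiv]

theorem finite_chainStep {R : (Fin n → ℝ) → (Fin n → ℤ)} (hR : IsQuantizer R)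
    {L : Matrix (Fin n) (Fin n) ℝ} (A : Finset (Fin n → ℤ)) (u : Fin n → ℝ) :
    (chainStep R L A u).Finite := by
  have hK : IsCompact (⋃ a ∈ A, (fun v => u + L⁻¹.mulVec (latticeCoe a + v)) ''
      closure (R ⁻¹' {0})) := by
    refine A.isCompact_biUnion fun a _ =>
      IsCompact.image hR.jordanMeasurable_cell.1.isCompact_closure ?_
    fun_prop
  obtain ⟨C, hC⟩ := hK.isBounded.exists_norm_le
  refine (Set.Finite.pi' fun _ : Fin n => Set.finite_Icc (-⌈C⌉) ⌈C⌉).subset fun z hz i => ?_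
  obtain ⟨a, ha, v, hv, h⟩ := hz
  have hz : ‖latticeCoe z‖ ≤ C := hC _ (Set.mem_biUnion ha ⟨v, subset_closure hv, h.symm⟩)
  have hzi : -(⌈C⌉ : ℝ) ≤ z i ∧ (z i : ℝ) ≤ ⌈C⌉ :=
    abs_le.1 (((norm_le_pi_norm (latticeCoe z) i).trans hz).trans (Int.le_ceil C))
  exact ⟨by exact_mod_cast hzi.1, by exact_mod_cast hzi.2⟩

theorem nullMeasurableSet_mem_chainStep {R : (Fin n → ℝ) → (Fin n → ℤ)} (hR : IsQuantizer R)
    {L : Matrix (Fin n) (Fin n) ℝ} (hL : IsUnit L.det) (A : Finset (Fin n → ℤ))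
    (z : Fin n → ℤ) : NullMeasurableSet {u | z ∈ chainStep R L A u} := by
  have heq : {u | z ∈ chainStep R L A u} =
      ⋃ a ∈ (A : Set (Fin n → ℤ)),
        (fun u => L.mulVec (latticeCoe z - u) - latticeCoe a) ⁻¹' (R ⁻¹' {0}) := by
    ext u
    simp [mem_chainStep_iff hL]
  rw [heq]
  refine .biUnion A.countable_toSet fun a _ => hR.nullMeasurableSet_cell.preimage ?_
  have hlin : Measure.QuasiMeasurePreserving (L.toLin' : (Fin n → ℝ) → Fin n → ℝ) := by
    refine Measure.LinearMap.quasiMeasurePreserving volume L.toLin' ?_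
    rw [LinearMap.det_toLin']
    exact hL.ne_zero
  exact ((measurePreserving_sub_right volume (latticeCoe a)).quasiMeasurePreserving.comp hlin).comp
    (Measure.measurePreserving_sub_left volume (latticeCoe z)).quasiMeasurePreserving

/-- The set of `u` in the compensating cell whose step of the chain is `B`; its volume is the
transition kernel. -/
def kernelSet (R : (Fin n → ℝ) → (Fin n → ℤ)) (L : Matrix (Fin n) (Fin n) ℝ)
    (B A : Finset (Fin n → ℤ)) : Set (Fin n → ℝ) :=
  {u | u ∈ compensatingQuantizer R L ⁻¹' {0} ∧ chainStep R L A u = (B : Set (Fin n → ℤ))}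

theorem nullMeasurableSet_kernelSet {R : (Fin n → ℝ) → (Fin n → ℤ)} (hR : IsQuantizer R)
    {L : Matrix (Fin n) (Fin n) ℝ} (hL : IsUnit L.det) (B A : Finset (Fin n → ℤ)) :
    NullMeasurableSet (kernelSet R L B A) := by
  have heq : kernelSet R L B A = compensatingQuantizer R L ⁻¹' {0} ∩
      ⋂ z, {u | z ∈ chainStep R L A u ↔ z ∈ B} := by
    ext u
    simp [kernelSet, Set.ext_iff]
  rw [heq]
  refine (hR.nullMeasurableSet_compensating_cell L).inter (.iInter fun z => ?_)
  by_cases hz : z ∈ B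
  · simpa [hz] using nullMeasurableSet_mem_chainStep hR hL A z
  · simp only [hz, iff_false]
    exact (nullMeasurableSet_mem_chainStep hR hL A z).compl

theorem iUnion_kernelSet {R : (Fin n → ℝ) → (Fin n → ℤ)} (hR : IsQuantizer R)
    (L : Matrix (Fin n) (Fin n) ℝ) (A : Finset (Fin n → ℤ)) :
    ⋃ B, kernelSet R L B A = compensatingQuantizer R L ⁻¹' {0} := by
  ext u
  simp only [kernelSet, Set.mem_iUnion]
  exact ⟨fun ⟨_, hu, _⟩ => hu,
    fun hu => ⟨(finite_chainStep hR A u).toFinset, hu, (Set.Finite.coe_toFinset _).symm⟩⟩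

theorem pairwise_disjoint_kernelSet (R : (Fin n → ℝ) → (Fin n → ℤ))
    (L : Matrix (Fin n) (Fin n) ℝ) (A : Finset (Fin n → ℤ)) :
    Pairwise (Function.onFun Disjoint fun B => kernelSet R L B A) := fun _ _ hBC =>
  Set.disjoint_left.2 fun _ hB hC => hBC (Finset.coe_injective (hB.2.symm.trans hC.2))

theorem volume_latticeResidues_eq_tsum {R : (Fin n → ℝ) → (Fin n → ℤ)} (hR : IsQuantizer R)
    {L : Matrix (Fin n) (Fin n) ℝ} (hL : IsUnit L.det) (N : ℕ) (A : Finset (Fin n → ℤ)) :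
    volume (latticeResidues (R ⁻¹' {0}) L (N + 1) (A : Set (Fin n → ℤ))) =
      ∑' B : NonemptyFinset n, volume (kernelSet R L B.1 A) *
        volume (latticeResidues (R ⁻¹' {0}) L N (B.1 : Set (Fin n → ℤ))) := by
  rw [volume_latticeResidues_succ hR hL, ← iUnion_kernelSet hR L A,
    lintegral_iUnion₀ (fun B => nullMeasurableSet_kernelSet hR hL B A)
      fun _ _ hBC => (pairwise_disjoint_kernelSet R L A hBC).aedisjoint]
  have hterm : ∀ B : Finset (Fin n → ℤ), ∫⁻ u in kernelSet R L B A,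
      volume (latticeResidues (R ⁻¹' {0}) L N (chainStep R L A u)) =
        volume (kernelSet R L B A) *
          volume (latticeResidues (R ⁻¹' {0}) L N (B : Set (Fin n → ℤ))) := fun B => by
    rw [mul_comm, ← setLIntegral_const]
    refine lintegral_congr_ae ?_
    filter_upwards [ae_restrict_mem₀ (nullMeasurableSet_kernelSet hR hL B A)] with u hu
    rw [hu.2]
  simp only [hterm]
  refine (tsum_subtype_eq_of_support_subset (s := {B : Finset (Fin n → ℤ) | B.Nonempty})
    fun B hB => ?_).symm
  rw [Set.mem_ofPred_eq, Finset.nonempty_iff_ne_empty]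
  rintro rfl
  simp [latticeResidues] at hB

/-! ### The recurrence for the survival function -/

theorem hasSum_survival_of_eq {R : (Fin n → ℝ) → (Fin n → ℤ)} (hR : IsQuantizer R)
    {L : Matrix (Fin n) (Fin n) ℝ} (hL : IsUnit L.det) (N : ℕ)
    (h : ∀ B : NonemptyFinset n, survival R L N B =
      (volume (latticeResidues (R ⁻¹' {0}) L N (B.1 : Set (Fin n → ℤ)))).toReal)
    (A : NonemptyFinset n) :
    HasSum (fun B : NonemptyFinset n => kernel R L B.1 A.1 * survival R L N B)
      (volume (latticeResidues (R ⁻¹' {0}) L (N + 1) (A.1 : Set (Fin n → ℤ)))).toReal := by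
  have htsum := volume_latticeResidues_eq_tsum hR hL N A.1
  have hfin : ∑' B : NonemptyFinset n, volume (kernelSet R L B.1 A.1) *
      volume (latticeResidues (R ⁻¹' {0}) L N (B.1 : Set (Fin n → ℤ))) ≠ ⊤ :=
    htsum ▸ measure_ne_top _ _
  rw [htsum, ENNReal.tsum_toReal_eq fun B => ENNReal.ne_top_of_tsum_ne_top hfin B]
  have hsum := ENNReal.hasSum_toReal hfin
  simp only [ENNReal.toReal_mul] at hsum ⊢
  simp only [h]
  exact hsum

theorem survival_eq_volume {R : (Fin n → ℝ) → (Fin n → ℤ)} (hR : IsQuantizer R)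
    {L : Matrix (Fin n) (Fin n) ℝ} (hL : IsUnit L.det) (N : ℕ) (A : NonemptyFinset n) :
    survival R L N A =
      (volume (latticeResidues (R ⁻¹' {0}) L N (A.1 : Set (Fin n → ℤ)))).toReal := by
  induction N generalizing A with
  | zero =>
    have : latticeResidues (R ⁻¹' {0}) L 0 (A.1 : Set (Fin n → ℤ)) = Set.univ := by
      obtain ⟨a, ha⟩ := A.2
      exact Set.eq_univ_of_forall fun θ => Set.mem_biUnion ha (by simp [pathResidues_zero])
    rw [this, measure_univ]
    rfl
  | succ N ih => exact (hasSum_survival_of_eq hR hL N ih A).tsum_eq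

end QuantizedLinear

end

theorem mainTheorem8 {n : ℕ} (R : (Fin n → ℝ) → (Fin n → ℤ))
    (hR : QuantizedLinear.IsQuantizer R) (L : Matrix (Fin n) (Fin n) ℝ)
    (hL : QuantizedLinear.IterativelyNonresonant L) :
    (∀ (N : ℕ) (A : QuantizedLinear.NonemptyFinset n),
        QuantizedLinear.survival R L N A ∈ Set.Icc (0 : ℝ) 1) ∧
      (∀ A : QuantizedLinear.NonemptyFinset n, QuantizedLinear.survival R L 0 A = 1) ∧
      (∀ (N : ℕ) (A : QuantizedLinear.NonemptyFinset n),
        HasSum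
          (fun B : QuantizedLinear.NonemptyFinset n =>
            QuantizedLinear.kernel R L B.1 A.1 * QuantizedLinear.survival R L N B)
          (QuantizedLinear.survival R L (N + 1) A)) ∧
      ∀ N : ℕ, 1 ≤ N →
        QuantizedLinear.HasFrequency (QuantizedLinear.reachable R L N)
          (QuantizedLinear.survival R L N (QuantizedLinear.originSet n)) := by
  have hvol := QuantizedLinear.survival_eq_volume hR hL.1
  refine ⟨fun N A => ?_, fun A => rfl, fun N A => ?_, fun N _ => ?_⟩
  · rw [hvol]
    exact ⟨ENNReal.toReal_nonneg, measureReal_le_one⟩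
  · rw [hvol (N + 1)]
    exact QuantizedLinear.hasSum_survival_of_eq hR hL.1 N (hvol N) A
  · rw [hvol]
    have h0 : QuantizedLinear.latticeCoe (0 : Fin n → ℤ) = 0 := by
      funext i
      simp [QuantizedLinear.latticeCoe]
    simpa [QuantizedLinear.latticeResidues, QuantizedLinear.originSet, h0] using
      QuantizedLinear.hasFrequency_reachable hR hL N
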